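/- **Setting.** A probabilistic control-flow graph (pCFG) $\mathcal C$ consists of a finite set $L$ of locations, real program variables $x_1,\dots,x_n$ of which $x_1,\dots,x_m$ ($m\le n$) are output variables (for $\mathbf x\in\mathbb R^n$ write $\mathbf x^{out}\in\mathbb R^m$ for the projection), an initial location $\ell_{init}$ and valuation $\mathbf x_{init}\in\mathbb R^n$, a terminal location $\ell_{out}$, and a finite set of transitions $\tau=(\ell,Pr)$ with source $\ell\in L$ and a probability distribution $Pr$ on $L$. Each $\tau$ carries a guard $G(\tau)$ (a predicate: a finite Boolean combination of inequalities between Borel-measurable expressions) and an update $(j,u)$ of one variable $x_j$, where $u$ is "no update", a Borel-measurable expression assigned to $x_j$, or a probability distribution on $\mathbb R$ from which $x_j$ is sampled. At each location the guards of the outgoing transitions cover $\mathbb R^n$ and are pairwise exclusive; the only transition from $\ell_{out}$ is a self-loop with guard true and no update. $Next(\tau,\mathbf x)$ is the random valuation obtained by applying the update of $\tau$ to $\mathbf x$. $\mathcal C$ defines a Markov process $Z_i=(\ell_i,\mathbf X_i)$ started in $(\ell_{init},\mathbf x_{init})$: in a state the unique enabled transition $\tau=(\ell,Pr)$ is taken,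 the next location is sampled from $Pr$ and, independently, the next valuation from $Next(\tau,\mathbf x)$. A run is a sequence of states starting in the initial state in which each state is a possible successor of the previous one (the new location has positive probability, a sampled value lies in the support of its distribution); a state is reachable if it ends a finite path of this kind. $TimeTerm$ is the first $i$ with $\ell_i=\ell_{out}$ ($\infty$ if there is none); $\mathcal C$ terminates almost surely if $\mathbb P(TimeTerm<\infty)=1$, and then its output distribution $\mu$ is the law of $\mathbf X_{TimeTerm}^{out}$ on $\mathbb R^m$. A state function $\eta$ assigns to each location a Borel-measurable function $\eta(\ell,\cdot):\mathbb R^n\to\mathbb R$. An invariant $I$ assigns to each location a predicate such that $\mathbf x\models I(\ell)$ for every reachable $(\ell,\mathbf x)$. For Borel $f:\mathbb R^m\to\mathbb R$, a UESM for $f$ w.r.t. $I$ is a state function $U_f$ with (1) $U_f(\ell_{out},\mathbf x)=0$ whenever $\mathbf x\models I(\ell_{out})$, and (2) for every transition $\tau=(\ell,Pr)$ and every $\mathbf x\models I(\ell)\wedge G(\tau)$, with $\mathbf N=Next(\tau,\mathbf x)$, $$U_f(\ell,\mathbf x)\ \ge\ \sum_{\ell'\in L}Pr(\ell')\,\mathbb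 E\big[U_f(\ell',\mathbf N)+f(\mathbf N^{out})\big]-f(\mathbf x^{out}),$$ where the sum is taken over the $\ell'$ with $Pr(\ell')>0$ and is required to be well defined in $[-\infty,\infty]$. An LESM $L_f$ is defined in the same way with $\le$ in place of $\ge$. For a state function $\eta$ put $Y_i=\eta(Z_i)+f(\mathbf X_i^{out})$, and let $\mathcal F_t$ be the $\sigma$-algebra generated by $Z_0,\dots,Z_t$. The triple $(\mathcal C,\eta,f)$ is OST-sound if $\mathbb E|Y_i|<\infty$ for all $i\ge 0$ and at least one of the following holds: * (C1) there is a constant $c$ with $TimeTerm\le c$ almost surely; * (C2) there is a constant $c$ with $|Y_{\min\{t,TimeTerm(\rho)\}}(\rho)|\le c$ for all $t\in\mathbb N$ and all runs $\rho$; * (C3) $\mathbb E[TimeTerm]<\infty$, $\mathbb E|Y_0|<\infty$, and there is a constant $c$ with $\mathbb E[|Y_{t+1}-Y_t|\mid\mathcal F_t]\le c$ almost surely for all $t\in\mathbb N$; * (C4) there are real numbers $M,c_1,c_2,d$ with $c_2>0$ such that $\mathbb P(TimeTerm>k)\le c_1e^{-c_2k}$ for all sufficiently large $k\in\mathbb N$,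 and $|Y_{k+1}-Y_k|\le M k^d$ almost surely for all $k\ge 1$. **Theorem 1 (Soundness of U/LESMs).** Let $\mathcal C$ be an almost-surely terminating pCFG with output distribution $\mu$, and let $f:\mathbb R^m\to\mathbb R$ be Borel measurable. Let $U_f$ be a UESM and $L_f$ an LESM for $f$, each with respect to some invariant, and assume that $(\mathcal C,U_f,f)$ and $(\mathcal C,L_f,f)$ are OST-sound. Then $\mathbb E_\mu[f]$ is well defined (that is, $f$ is $\mu$-integrable) and $$U_f(\ell_{init},\mathbf x_{init})+f(\mathbf x_{init}^{out})\ \ge\ \mathbb E_\mu[f]\ \ge\ L_f(\ell_{init},\mathbf x_{init})+f(\mathbf x_{init}^{out}).$$ -/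

import Mathlib

open MeasureTheory ProbabilityTheory Filter
open scoped ENNReal

/-! ## Expressions, predicates, updates -/

/-- An arithmetic expression over `n` real program variables, through its value function:
a Borel-measurable function `ℝⁿ → ℝ`, defined on all valuations. -/
structure BorelExpr (n : ℕ) where
  eval : (Fin n → ℝ) → ℝ
  measurable_eval : Measurable eval

/-- Predicates: finite Boolean combinations of atomic predicates `E₁ ≤ E₂`. -/
inductive Predicate (n : ℕ) where
  | le (E₁ E₂ : BorelExpr n) : Predicate n
  | and (Φ Ψ : Predicate n) : Predicate n
  | or (Φ Ψ : Predicate n) : Predicate n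
  | not (Φ : Predicate n) : Predicate n

/-- `Φ.Sat x` is the satisfaction relation `x ⊨ Φ`. -/
def Predicate.Sat {n : ℕ} : Predicate n → (Fin n → ℝ) → Prop
  | .le E₁ E₂, x => E₁.eval x ≤ E₂.eval x
  | .and Φ Ψ, x => Φ.Sat x ∧ Ψ.Sat x
  | .or Φ Ψ, x => Φ.Sat x ∨ Ψ.Sat x
  | .not Φ, x => ¬ Φ.Sat x

theorem Predicate.measurableSet_sat {n : ℕ} (Φ : Predicate n) : MeasurableSet {x | Φ.Sat x} := by
  induction Φ with
  | le E₁ E₂ => exact measurableSet_le E₁.measurable_eval E₂.measurable_eval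
  | and Φ Ψ h₁ h₂ => exact h₁.inter h₂
  | or Φ Ψ h₁ h₂ => exact h₁.union h₂
  | not Φ h => exact h.compl

/-- Update elements: no update `⊥`, a deterministic assignment, or sampling from a probability
distribution on `ℝ`. -/
inductive UpdateElt (n : ℕ) where
  | bot : UpdateElt n
  | assign (u : BorelExpr n) : UpdateElt n
  | sample (δ : ProbabilityMeasure ℝ) : UpdateElt n

/-- The law of the successor valuation `Next(τ, x)` of a transition `τ` with update `(j, u)`. -/
noncomputable def UpdateElt.law {n : ℕ} (j : Fin n) (u : UpdateElt n) (x : Fin n → ℝ) :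
    Measure (Fin n → ℝ) :=
  match u with
  | .bot => Measure.dirac x
  | .assign u => Measure.dirac (Function.update x j (u.eval x))
  | .sample δ => (δ : Measure ℝ).map (fun v => Function.update x j v)

/-- The valuation `y` can be obtained by applying the update `(j, u)` to the valuation `x`
(a sampled value is a point of the support of the distribution). -/
def UpdateElt.CanYield {n : ℕ} (j : Fin n) (u : UpdateElt n) (x y : Fin n → ℝ) : Prop :=
  match u with
  | .bot => y = x
  | .assign u => y = Function.update x j (u.eval x)
  | .sample δ => ∃ v ∈ (δ : Measure ℝ).support, y = Function.update x j v

theorem UpdateElt.measurable_update {n : ℕ} (j : Fin n) :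
    Measurable fun p : (Fin n → ℝ) × ℝ => Function.update p.1 j p.2 := by
  refine measurable_pi_iff.2 fun i => ?_
  by_cases h : i = j
  · subst h
    simpa using measurable_snd
  · simp only [Function.update_of_ne h]
    exact (measurable_pi_apply i).comp measurable_fst

instance UpdateElt.isProbabilityMeasure_law {n : ℕ} (j : Fin n) (u : UpdateElt n)
    (x : Fin n → ℝ) : IsProbabilityMeasure (u.law j x) := by
  cases u with
  | bot => exact Measure.dirac.isProbabilityMeasure
  | assign u => exact Measure.dirac.isProbabilityMeasure
  | sample δ =>
    exact Measure.isProbabilityMeasure_map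
      ((UpdateElt.measurable_update j).comp measurable_prodMk_left).aemeasurable

theorem UpdateElt.measurable_law {n : ℕ} (j : Fin n) (u : UpdateElt n) :
    Measurable (u.law j) := by
  cases u with
  | bot => exact Measure.measurable_dirac
  | assign u =>
    exact Measure.measurable_dirac.comp
      ((UpdateElt.measurable_update j).comp (measurable_id.prodMk u.measurable_eval))
  | sample δ =>
    have h : (UpdateElt.sample δ).law j = fun x : Fin n → ℝ =>
        (((δ : Measure ℝ).map (Prod.mk x))).map
          (fun p : (Fin n → ℝ) × ℝ => Function.update p.1 j p.2) := by
      funext x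
      rw [Measure.map_map (UpdateElt.measurable_update j) measurable_prodMk_left]
      rfl
    rw [h]
    exact (Measure.measurable_map _ (UpdateElt.measurable_update j)).comp
      Measurable.map_prodMk_left

/-! ## Probabilistic control-flow graphs -/

/-- A probabilistic control-flow graph with finite location set `L`, program variables
`x₁, …, xₙ`, and output variables `x₁, …, xₘ`. -/
structure PCFG (L : Type*) (n m : ℕ) where
  /-- the output variables are the first `m` program variables -/
  out_le : m ≤ n
  /-- initial location -/
  locInit : L
  /-- initial valuation -/
  valInit : Fin n → ℝ
  /-- terminal location -/
  locOut : L
  /-- the finite set of transitions `(ℓ, Pr)` -/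
  transitions : Finset (L × PMF L)
  /-- guards -/
  guard : transitions → Predicate n
  /-- updates: target variable index and update element -/
  up : transitions → Fin n × UpdateElt n
  /-- at every location the guards of the outgoing transitions cover all valuations -/
  guard_total : ∀ (ℓ : L) (x : Fin n → ℝ), ∃ τ : transitions, τ.1.1 = ℓ ∧ (guard τ).Sat x
  /-- guards of distinct transitions with the same source are mutually exclusive -/
  guard_exclusive : ∀ τ₁ τ₂ : transitions, τ₁.1.1 = τ₂.1.1 → τ₁ ≠ τ₂ →
    ∀ x : Fin n → ℝ, ¬ ((guard τ₁).Sat x ∧ (guard τ₂).Sat x)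
  /-- the terminal location has exactly one outgoing transition, a self-loop with guard `true`
  and no update -/
  locOut_loop : ∃ τ : transitions, (∀ τ' : transitions, τ'.1.1 = locOut ↔ τ' = τ) ∧
    τ.1.2 locOut = 1 ∧ (∀ x : Fin n → ℝ, (guard τ).Sat x) ∧ (up τ).2 = UpdateElt.bot

/-- A state function assigns to every location a Borel-measurable function of the valuation. -/
abbrev StateFunction (L : Type*) (n : ℕ) := L → BorelExpr n

/-- A predicate function assigns to every location a predicate over the program variables. -/
abbrev PredicateFunction (L : Type*) (n : ℕ) := L → Predicate n

namespace PCFG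

/-- States `(ℓ, x)`. -/
abbrev State (L : Type*) (n : ℕ) := L × (Fin n → ℝ)

/-- The initial state. -/
def init {L : Type*} {n m : ℕ} (C : PCFG L n m) : State L n := (C.locInit, C.valInit)

/-- The projection `x ↦ x^out` of a valuation to the output variables. -/
def proj {L : Type*} {n m : ℕ} (C : PCFG L n m) (x : Fin n → ℝ) : Fin m → ℝ :=
  fun i => x (Fin.castLE C.out_le i)

/-- The transition `τ` is enabled at the state `s`. -/
def Enabled {L : Type*} {n m : ℕ} (C : PCFG L n m) (τ : C.transitions) (s : State L n) : Prop :=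
  τ.1.1 = s.1 ∧ (C.guard τ).Sat s.2

/-- The law of `Next(τ, x)`. -/
noncomputable def nextLaw {L : Type*} {n m : ℕ} (C : PCFG L n m) (τ : C.transitions)
    (x : Fin n → ℝ) : Measure (Fin n → ℝ) :=
  (C.up τ).2.law (C.up τ).1 x

/-- The state `s'` is a successor of the state `s`. -/
def Succ {L : Type*} {n m : ℕ} (C : PCFG L n m) (s s' : State L n) : Prop :=
  ∃ τ : C.transitions, C.Enabled τ s ∧ 0 < τ.1.2 s'.1 ∧
    (C.up τ).2.CanYield (C.up τ).1 s.2 s'.2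

/-- A state is reachable if some finite path from the initial state ends in it. -/
def Reachable {L : Type*} {n m : ℕ} (C : PCFG L n m) (s : State L n) : Prop :=
  Relation.ReflTransGen C.Succ C.init s

/-- Runs: infinite sequences of states all of whose finite prefixes are finite paths. -/
def IsRun {L : Type*} {n m : ℕ} (C : PCFG L n m) (ρ : ℕ → State L n) : Prop :=
  ρ 0 = C.init ∧ ∀ i, C.Succ (ρ i) (ρ (i + 1))

/-! ### Semantics -/

theorem existsUnique_enabled {L : Type*} {n m : ℕ} (C : PCFG L n m) (s : State L n) :
    ∃! τ : C.transitions, C.Enabled τ s := by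
  obtain ⟨τ, h₁, h₂⟩ := C.guard_total s.1 s.2
  refine ⟨τ, ⟨h₁, h₂⟩, fun τ' h' => ?_⟩
  by_contra hne
  exact C.guard_exclusive τ' τ (h'.1.trans h₁.symm) hne s.2 ⟨h'.2, h₂⟩

/-- The unique transition enabled at a state. -/
noncomputable def enabledTransition {L : Type*} {n m : ℕ} (C : PCFG L n m) (s : State L n) :
    C.transitions :=
  (C.existsUnique_enabled s).choose

theorem enabledTransition_eq_iff {L : Type*} {n m : ℕ} (C : PCFG L n m) (s : State L n)
    (τ : C.transitions) : C.enabledTransition s = τ ↔ C.Enabled τ s := by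
  have h := (C.existsUnique_enabled s).choose_spec
  exact ⟨fun e => e ▸ h.1, fun e => (h.2 τ e).symm⟩

/-- The one-step law from the state `s`: with `τ = (ℓ, Pr)` the transition enabled at `s`, the
successor location is sampled from `Pr` and, independently, the successor valuation from the law of
`Next(τ, x)`. -/
noncomputable def stepLaw {L : Type*} [MeasurableSpace L] {n m : ℕ} (C : PCFG L n m)
    (s : State L n) : Measure (State L n) :=
  (C.enabledTransition s).1.2.toMeasure.prod (C.nextLaw (C.enabledTransition s) s.2)

theorem measurable_prod_nextLaw {L : Type*} [MeasurableSpace L] {n m : ℕ} (C : PCFG L n m)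
    (τ : C.transitions) :
    Measurable fun x : Fin n → ℝ => τ.1.2.toMeasure.prod (C.nextLaw τ x) := by
  obtain ⟨κ, hκ⟩ : ∃ κ : Kernel (Fin n → ℝ) (Fin n → ℝ), ∀ x, κ x = C.nextLaw τ x :=
    ⟨⟨C.nextLaw τ, UpdateElt.measurable_law _ _⟩, fun _ => rfl⟩
  have : IsMarkovKernel κ := ⟨fun x => by
    rw [hκ]
    exact UpdateElt.isProbabilityMeasure_law _ _ x⟩
  have h : (fun x : Fin n → ℝ => τ.1.2.toMeasure.prod (C.nextLaw τ x)) =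
      ⇑(Kernel.const (Fin n → ℝ) τ.1.2.toMeasure ×ₖ κ) := by
    funext x
    rw [Kernel.prod_apply, Kernel.const_apply, hκ]
  rw [h]
  exact Kernel.measurable _

theorem measurableSet_enabled {L : Type*} [MeasurableSpace L] [DiscreteMeasurableSpace L]
    {n m : ℕ} (C : PCFG L n m) (τ : C.transitions) :
    MeasurableSet {s : State L n | C.Enabled τ s} :=
  (measurable_fst (MeasurableSet.of_discrete (s := {ℓ : L | τ.1.1 = ℓ}))).inter
    (measurable_snd (C.guard τ).measurableSet_sat)

theorem measurable_stepLaw {L : Type*} [MeasurableSpace L] [DiscreteMeasurableSpace L]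
    {n m : ℕ} (C : PCFG L n m) : Measurable C.stepLaw := by
  intro B hB
  have h : C.stepLaw ⁻¹' B = ⋃ τ : C.transitions, {s : State L n | C.Enabled τ s} ∩
      Prod.snd ⁻¹' ((fun x => τ.1.2.toMeasure.prod (C.nextLaw τ x)) ⁻¹' B) := by
    ext s
    simp only [Set.mem_preimage, Set.mem_iUnion, Set.mem_inter_iff, Set.mem_ofPred_eq,
      ← enabledTransition_eq_iff]
    exact ⟨fun hs => ⟨_, rfl, hs⟩, fun ⟨τ, e, hs⟩ => by subst e; exact hs⟩
  rw [h]
  exact MeasurableSet.iUnion fun τ =>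
    (C.measurableSet_enabled τ).inter (measurable_snd (C.measurable_prod_nextLaw τ hB))

/-- The transition kernel of the Markov process of a pCFG. -/
noncomputable def stepKernel {L : Type*} [Fintype L] [MeasurableSpace L]
    [DiscreteMeasurableSpace L] {n m : ℕ} (C : PCFG L n m) : Kernel (State L n) (State L n) :=
  ⟨C.stepLaw, C.measurable_stepLaw⟩

instance isMarkovKernel_stepKernel {L : Type*} [Fintype L] [MeasurableSpace L]
    [DiscreteMeasurableSpace L] {n m : ℕ} (C : PCFG L n m) : IsMarkovKernel C.stepKernel := by
  refine ⟨fun s => ?_⟩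
  have : IsProbabilityMeasure (C.nextLaw (C.enabledTransition s) s.2) :=
    UpdateElt.isProbabilityMeasure_law _ _ _
  exact inferInstanceAs (IsProbabilityMeasure
    ((C.enabledTransition s).1.2.toMeasure.prod (C.nextLaw (C.enabledTransition s) s.2)))

/-- The step kernel as a function of the history up to time `k` (only the last state matters). -/
noncomputable def historyKernel {L : Type*} [Fintype L] [MeasurableSpace L]
    [DiscreteMeasurableSpace L] {n m : ℕ} (C : PCFG L n m) (k : ℕ) :
    Kernel (Π _ : Finset.Iic k, State L n) (State L n) :=
  C.stepKernel.comap (fun h => h ⟨k, Finset.mem_Iic.2 le_rfl⟩) (measurable_pi_apply _)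

instance isMarkovKernel_historyKernel {L : Type*} [Fintype L] [MeasurableSpace L]
    [DiscreteMeasurableSpace L] {n m : ℕ} (C : PCFG L n m) (k : ℕ) :
    IsMarkovKernel (C.historyKernel k) := by
  unfold historyKernel
  infer_instance

/-- The law of the Markov process of `C` started in the initial state, as a probability measure on
the space of all state sequences (it is carried by the runs), by the Ionescu-Tulcea theorem. -/
noncomputable def runMeasure {L : Type*} [Fintype L] [MeasurableSpace L]
    [DiscreteMeasurableSpace L] {n m : ℕ} (C : PCFG L n m) : Measure (ℕ → State L n) :=
  Kernel.traj (X := fun _ => State L n) C.historyKernel 0 (fun _ => C.init)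

instance isProbabilityMeasure_runMeasure {L : Type*} [Fintype L] [MeasurableSpace L]
    [DiscreteMeasurableSpace L] {n m : ℕ} (C : PCFG L n m) :
    IsProbabilityMeasure C.runMeasure := by
  unfold runMeasure
  infer_instance

/-- The termination time: the first time the terminal location is visited, `⊤` if there is none. -/
noncomputable def timeTerm {L : Type*} {n m : ℕ} (C : PCFG L n m) (ρ : ℕ → State L n) : ℕ∞ :=
  ⨅ (i : ℕ) (_ : (ρ i).1 = C.locOut), (i : ℕ∞)

/-- Almost-sure termination. -/
def AlmostSurelyTerminating {L : Type*} [Fintype L] [MeasurableSpace L]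
    [DiscreteMeasurableSpace L] {n m : ℕ} (C : PCFG L n m) : Prop :=
  C.runMeasure {ρ | ∃ i, (ρ i).1 = C.locOut} = 1

/-- The output of a terminating run: the projected valuation at the termination time (which does
not change afterwards). On non-terminating sequences the value is irrelevant. -/
noncomputable def output {L : Type*} {n m : ℕ} (C : PCFG L n m) (ρ : ℕ → State L n) : Fin m → ℝ :=
  C.proj (ρ (C.timeTerm ρ).toNat).2

theorem measurable_timeTerm {L : Type*} [Fintype L] [MeasurableSpace L]
    [DiscreteMeasurableSpace L] {n m : ℕ} (C : PCFG L n m) : Measurable C.timeTerm := by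
  have hle : ∀ k : ℕ, MeasurableSet {ρ : ℕ → State L n | (ρ k).1 = C.locOut} := fun k =>
    (measurable_fst.comp (measurable_pi_apply k)) (MeasurableSet.of_discrete (s := {C.locOut}))
  have hle' : ∀ k : ℕ, MeasurableSet {ρ : ℕ → State L n | (k : ℕ∞) ≤ C.timeTerm ρ} := by
    intro k
    have : {ρ : ℕ → State L n | (k : ℕ∞) ≤ C.timeTerm ρ} =
        ⋂ i : ℕ, ⋂ _ : i < k, {ρ | (ρ i).1 = C.locOut}ᶜ := by
      ext ρ
      simp only [timeTerm, Set.mem_ofPred_eq, le_iInf_iff, Nat.cast_le, Set.mem_iInter,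
        Set.mem_compl_iff]
      exact ⟨fun h i hi e => absurd (h i e) (not_le.2 hi),
        fun h i e => not_lt.1 fun hi => h i hi e⟩
    rw [this]
    exact MeasurableSet.iInter fun i => MeasurableSet.iInter fun _ => (hle i).compl
  refine measurable_to_countable' fun y => ?_
  induction y using ENat.recTopCoe with
  | top =>
    have : C.timeTerm ⁻¹' {⊤} = ⋂ k : ℕ, {ρ | (k : ℕ∞) ≤ C.timeTerm ρ} := by
      ext ρ
      simp only [Set.mem_preimage, Set.mem_singleton_iff, Set.mem_iInter, Set.mem_ofPred_eq]
      exact ⟨fun h k => h ▸ le_top, fun h => ENat.eq_top_iff_forall_ge.2 h⟩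
    rw [this]
    exact MeasurableSet.iInter hle'
  | coe k =>
    have : C.timeTerm ⁻¹' {(k : ℕ∞)} = {ρ | (k : ℕ∞) ≤ C.timeTerm ρ} \
        {ρ | ((k + 1 : ℕ) : ℕ∞) ≤ C.timeTerm ρ} := by
      ext ρ
      simp only [Set.mem_preimage, Set.mem_singleton_iff, Set.mem_sdiff, Set.mem_ofPred_eq,
        Nat.cast_add, Nat.cast_one, ENat.add_one_le_iff (ENat.natCast_ne_top k), not_lt]
      exact ⟨fun h => ⟨h.ge, h.le⟩, fun h => le_antisymm h.2 h.1⟩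
    rw [this]
    exact (hle' k).diff (hle' (k + 1))

theorem measurable_output {L : Type*} [Fintype L] [MeasurableSpace L]
    [DiscreteMeasurableSpace L] {n m : ℕ} (C : PCFG L n m) : Measurable C.output := by
  have h₁ : Measurable fun ρ : ℕ → State L n => (C.timeTerm ρ).toNat :=
    (Measurable.of_discrete (f := ENat.toNat)).comp C.measurable_timeTerm
  have h₂ : Measurable fun p : ℕ × (ℕ → State L n) => p.2 p.1 :=
    measurable_from_prod_countable_right fun k => measurable_pi_apply k
  have h₃ : Measurable C.proj := measurable_pi_iff.2 fun i => measurable_pi_apply _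
  exact h₃.comp (measurable_snd.comp (h₂.comp (h₁.prodMk measurable_id)))

/-- The output distribution (of an almost-surely terminating pCFG): the probability of a Borel set
`B` is the probability that the output lies in `B`. -/
noncomputable def outputDist {L : Type*} [Fintype L] [MeasurableSpace L]
    [DiscreteMeasurableSpace L] {n m : ℕ} (C : PCFG L n m) : Measure (Fin m → ℝ) :=
  C.runMeasure.map C.output

/-! ### Invariants, expectation supermartingales and submartingales -/

/-- A predicate function is an invariant if it contains all reachable states. -/
def IsInvariant {L : Type*} {n m : ℕ} (C : PCFG L n m) (I : PredicateFunction L n) : Prop :=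
  ∀ s : State L n, C.Reachable s → (I s.1).Sat s.2

/-- Upper expectation supermartingales for `f` with respect to `I`. The expectations in
`∑ ℓ', Pr ℓ' * E[U(ℓ', N) + f(N^out)]` are taken in `[-∞, ∞]`, and locations with `Pr ℓ' = 0`
contribute `0`; so the inequality `U(ℓ, x) ≥ ∑ … - f(x^out)` says that no positive part has infinite
expectation and that, when the sum is not `-∞`, the inequality holds between real numbers. -/
structure IsUESM {L : Type*} [Fintype L] {n m : ℕ} (C : PCFG L n m) (I : PredicateFunction L n)
    (f : (Fin m → ℝ) → ℝ) (U : StateFunction L n) : Prop where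
  zero_on_output : ∀ x, (I C.locOut).Sat x → (U C.locOut).eval x = 0
  expected_lt_top : ∀ (τ : C.transitions) (x : Fin n → ℝ),
    (I τ.1.1).Sat x → (C.guard τ).Sat x → ∀ ℓ', τ.1.2 ℓ' ≠ 0 →
      ∫⁻ y, ENNReal.ofReal ((U ℓ').eval y + f (C.proj y)) ∂(C.nextLaw τ x) < ⊤
  expected_decrease : ∀ (τ : C.transitions) (x : Fin n → ℝ),
    (I τ.1.1).Sat x → (C.guard τ).Sat x →
    (∀ ℓ', τ.1.2 ℓ' ≠ 0 →
      Integrable (fun y => (U ℓ').eval y + f (C.proj y)) (C.nextLaw τ x)) →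
    (U τ.1.1).eval x ≥
      (∑ ℓ', (τ.1.2 ℓ').toReal * ∫ y, ((U ℓ').eval y + f (C.proj y)) ∂(C.nextLaw τ x))
        - f (C.proj x)

/-- Lower expectation submartingales for `f` with respect to `I`; dual to `IsUESM`. -/
structure IsLESM {L : Type*} [Fintype L] {n m : ℕ} (C : PCFG L n m) (I : PredicateFunction L n)
    (f : (Fin m → ℝ) → ℝ) (Λ : StateFunction L n) : Prop where
  zero_on_output : ∀ x, (I C.locOut).Sat x → (Λ C.locOut).eval x = 0
  bot_lt_expected : ∀ (τ : C.transitions) (x : Fin n → ℝ),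
    (I τ.1.1).Sat x → (C.guard τ).Sat x → ∀ ℓ', τ.1.2 ℓ' ≠ 0 →
      ∫⁻ y, ENNReal.ofReal (-((Λ ℓ').eval y + f (C.proj y))) ∂(C.nextLaw τ x) < ⊤
  expected_increase : ∀ (τ : C.transitions) (x : Fin n → ℝ),
    (I τ.1.1).Sat x → (C.guard τ).Sat x →
    (∀ ℓ', τ.1.2 ℓ' ≠ 0 →
      Integrable (fun y => (Λ ℓ').eval y + f (C.proj y)) (C.nextLaw τ x)) →
    (Λ τ.1.1).eval x ≤
      (∑ ℓ', (τ.1.2 ℓ').toReal * ∫ y, ((Λ ℓ').eval y + f (C.proj y)) ∂(C.nextLaw τ x))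
        - f (C.proj x)

/-! ### OST-soundness -/

/-- The process `Y_i = η(Z_i) + f(X_i^out)`, where `Z_i = (ℓ_i, X_i)` is the `i`-th state. -/
def process {L : Type*} {n m : ℕ} (C : PCFG L n m) (η : StateFunction L n)
    (f : (Fin m → ℝ) → ℝ) (i : ℕ) (ρ : ℕ → State L n) : ℝ :=
  (η (ρ i).1).eval (ρ i).2 + f (C.proj (ρ i).2)

/-- (C1): the termination time is almost surely bounded. -/
def OSTC1 {L : Type*} [Fintype L] [MeasurableSpace L] [DiscreteMeasurableSpace L] {n m : ℕ}
    (C : PCFG L n m) : Prop :=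
  ∃ c : ℕ, ∀ᵐ ρ ∂C.runMeasure, C.timeTerm ρ ≤ c

/-- (C2): `Y` is uniformly bounded on all runs up to termination. -/
def OSTC2 {L : Type*} {n m : ℕ} (C : PCFG L n m) (η : StateFunction L n)
    (f : (Fin m → ℝ) → ℝ) : Prop :=
  ∃ c : ℝ, ∀ (t : ℕ) (ρ : ℕ → State L n), C.IsRun ρ →
    |C.process η f (min (t : ℕ∞) (C.timeTerm ρ)).toNat ρ| ≤ c

/-- (C3): finite expected termination time and uniformly bounded conditional expected one-step
change, given the first `t` steps (the `σ`-algebra generated by the states `Z_0, …, Z_t`). -/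
def OSTC3 {L : Type*} [Fintype L] [MeasurableSpace L] [DiscreteMeasurableSpace L] {n m : ℕ}
    (C : PCFG L n m) (η : StateFunction L n) (f : (Fin m → ℝ) → ℝ) : Prop :=
  ∫⁻ ρ, (C.timeTerm ρ : ℝ≥0∞) ∂C.runMeasure < ⊤ ∧
  Integrable (C.process η f 0) C.runMeasure ∧
  ∃ c : ℝ, ∀ t : ℕ,
    C.runMeasure[fun ρ => |C.process η f (t + 1) ρ - C.process η f t ρ| |
      Filtration.piLE (X := fun _ : ℕ => State L n) t] ≤ᵐ[C.runMeasure] fun _ => c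

/-- (C4): exponentially decreasing tails of the termination time and polynomially bounded one-step
change. -/
def OSTC4 {L : Type*} [Fintype L] [MeasurableSpace L] [DiscreteMeasurableSpace L] {n m : ℕ}
    (C : PCFG L n m) (η : StateFunction L n) (f : (Fin m → ℝ) → ℝ) : Prop :=
  ∃ M c₁ c₂ d : ℝ, 0 < c₂ ∧
    (∀ᶠ k : ℕ in atTop,
      C.runMeasure.real {ρ | (k : ℕ∞) < C.timeTerm ρ} ≤ c₁ * Real.exp (-c₂ * k)) ∧
    ∀ k : ℕ, 1 ≤ k → ∀ᵐ ρ ∂C.runMeasure,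
      |C.process η f (k + 1) ρ - C.process η f k ρ| ≤ M * (k : ℝ) ^ d

/-- OST-soundness of `(C, η, f)`. -/
def OSTSound {L : Type*} [Fintype L] [MeasurableSpace L] [DiscreteMeasurableSpace L] {n m : ℕ}
    (C : PCFG L n m) (η : StateFunction L n) (f : (Fin m → ℝ) → ℝ) : Prop :=
  (∀ i, Integrable (C.process η f i) C.runMeasure) ∧
    (C.OSTC1 ∨ C.OSTC2 η f ∨ C.OSTC3 η f ∨ C.OSTC4 η f)

end PCFG

/-!
By the Markov property, `Y t = η (Z t) + f (X t)` is a supermartingale when `η` is a UESM and a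
submartingale when `η` is an LESM, so `E[Y t]` moves monotonically away from the constant `Y 0`.
Since `ℓ_out` is absorbing and `η` vanishes there, `Y t` equals `f` of the output for every
`t ≥ TimeTerm`. It remains to see that `E[Y t]` converges to `E_μ[f]`, by dominated convergence.
The majorant is constant under (C2). Otherwise it is `|Y 0| + ∑ t, |Y (t + 1) - Y t|`, which is
integrable because the `t`-th increment vanishes from `TimeTerm` on: it is zero for `t ≥ c` under
(C1), and of `L¹` norm at most `c * P(TimeTerm > t)` under (C3) and `M * t ^ d * P(TimeTerm > t)`
under (C4), which is summable in both cases.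
-/

theorem ae_pmf_toMeasure_iff {α : Type*} [MeasurableSpace α] [DiscreteMeasurableSpace α]
    (p : PMF α) {q : α → Prop} : (∀ᵐ a ∂p.toMeasure, q a) ↔ ∀ a, p a ≠ 0 → q a := by
  rw [ae_iff, PMF.toMeasure_apply_eq_zero_iff _ .of_discrete, Set.disjoint_left]
  simp [PMF.mem_support_iff]

theorem measurable_piLE_eval {ι : Type*} [Preorder ι] {X : ι → Type*}
    [∀ i, MeasurableSpace (X i)] (i : ι) :
    Measurable[Filtration.piLE (X := X) i] fun x : Π i, X i => x i := fun s hs =>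
  ⟨{x | x ⟨i, Set.mem_Iic.2 le_rfl⟩ ∈ s}, measurable_pi_apply _ hs, rfl⟩

section Martingales

variable {Ω ι : Type*} [Preorder ι] {mΩ : MeasurableSpace Ω} {P : Measure Ω}
  {ℱ : Filtration ι mΩ} [SigmaFiniteFiltration P ℱ] {Y : ι → Ω → ℝ}

theorem antitone_integral_of_supermartingale (hY : Supermartingale Y ℱ P) :
    Antitone fun i => ∫ ω, Y i ω ∂P := fun i j hij => by
  simpa using hY.setIntegral_le hij MeasurableSet.univ

theorem monotone_integral_of_submartingale (hY : Submartingale Y ℱ P) :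
    Monotone fun i => ∫ ω, Y i ω ∂P := fun i j hij => by
  simpa using hY.setIntegral_le hij MeasurableSet.univ

end Martingales

theorem encard_setOf_natCast_lt (a : ℕ∞) : {t : ℕ | (t : ℕ∞) < a}.encard = a := by
  cases a with
  | top => simp
  | coe k =>
    have hrange : {t : ℕ | (t : ℕ∞) < k} = Finset.range k := by ext; simp
    rw [hrange, Set.encard_coe_eq_coe_finsetCard, Finset.card_range]

section TailSums

variable {Ω : Type*} {mΩ : MeasurableSpace Ω} {P : Measure Ω}

theorem tsum_measure_lt_eq_lintegral {T : Ω → ℕ∞} (hT : AEMeasurable T P) :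
    ∑' t : ℕ, P {ω | (t : ℕ∞) < T ω} = ∫⁻ ω, (T ω : ℝ≥0∞) ∂P := by
  have hmeas (t : ℕ) : NullMeasurableSet {ω | (t : ℕ∞) < T ω} P :=
    hT.nullMeasurableSet_preimage (MeasurableSet.of_discrete (s := Set.Ioi (t : ℕ∞)))
  have hind (t : ℕ) : AEMeasurable ({ω | (t : ℕ∞) < T ω}.indicator (1 : Ω → ℝ≥0∞)) P :=
    aemeasurable_one.indicator₀ (hmeas t)
  simp only [← lintegral_indicator_one₀ (hmeas _)]
  rw [← lintegral_tsum hind]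
  refine lintegral_congr fun ω => ?_
  calc ∑' t : ℕ, {ω | (t : ℕ∞) < T ω}.indicator (1 : Ω → ℝ≥0∞) ω
      = ∑' _ : {t : ℕ | (t : ℕ∞) < T ω}, (1 : ℝ≥0∞) :=
        (tsum_subtype {t : ℕ | (t : ℕ∞) < T ω} fun _ => (1 : ℝ≥0∞)).symm
    _ = T ω := by rw [ENNReal.tsum_set_one, encard_setOf_natCast_lt]

theorem summable_measureReal_lt {T : Ω → ℕ∞} (hT : AEMeasurable T P)
    (hfin : ∫⁻ ω, (T ω : ℝ≥0∞) ∂P < ⊤) :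
    Summable fun t : ℕ => P.real {ω | (t : ℕ∞) < T ω} :=
  ENNReal.summable_toReal ((tsum_measure_lt_eq_lintegral hT).trans_lt hfin).ne

theorem summable_mul_rpow_of_isBigO_exp {p : ℕ → ℝ} {c : ℝ} (d : ℝ) (hc : 0 < c)
    (hp : p =O[atTop] fun k : ℕ => Real.exp (-c * k)) :
    Summable fun k => p k * (k : ℝ) ^ d := by
  refine summable_of_isBigO_nat (Real.summable_pow_mul_exp_neg_nat_mul ⌈d⌉₊ hc) ?_
  have hpow : (fun k : ℕ => (k : ℝ) ^ d) =O[atTop] fun k => (k : ℝ) ^ ⌈d⌉₊ := by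
    refine .of_norm_eventuallyLE ?_
    filter_upwards [eventually_ge_atTop 1] with k hk
    rw [Real.norm_of_nonneg (by positivity), ← Real.rpow_natCast]
    exact Real.rpow_le_rpow_of_exponent_le (by exact_mod_cast hk) (Nat.le_ceil d)
  exact (hp.mul hpow).trans_eventuallyEq <| .of_eq (funext fun k => mul_comm _ _)

end TailSums

section Increments

variable {Ω E : Type*} {mΩ : MeasurableSpace Ω} {P : Measure Ω} [NormedAddCommGroup E]

theorem enorm_le_add_tsum_enorm_sub (y : ℕ → E) (n : ℕ) :
    ‖y n‖ₑ ≤ ‖y 0‖ₑ + ∑' t, ‖y (t + 1) - y t‖ₑ :=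
  calc ‖y n‖ₑ = ‖y 0 + ∑ t ∈ Finset.range n, (y (t + 1) - y t)‖ₑ := by
        rw [Finset.sum_range_sub, add_sub_cancel]
    _ ≤ ‖y 0‖ₑ + ∑ t ∈ Finset.range n, ‖y (t + 1) - y t‖ₑ :=
        (enorm_add_le _ _).trans (by gcongr; exact enorm_sum_le _ _)
    _ ≤ ‖y 0‖ₑ + ∑' t, ‖y (t + 1) - y t‖ₑ := by gcongr; exact ENNReal.sum_le_tsum _

theorem exists_integrable_bound_of_summable {Y : ℕ → Ω → E} (hY : ∀ t, Integrable (Y t) P)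
    (hsum : Summable fun t => ∫ ω, ‖Y (t + 1) ω - Y t ω‖ ∂P) :
    ∃ G : Ω → ℝ, Integrable G P ∧ ∀ᵐ ω ∂P, ∀ t, ‖Y t ω‖ ≤ G ω := by
  have hincr (t : ℕ) : Integrable (fun ω => Y (t + 1) ω - Y t ω) P := (hY _).sub (hY t)
  let G (ω : Ω) : ℝ≥0∞ := ‖Y 0 ω‖ₑ + ∑' t, ‖Y (t + 1) ω - Y t ω‖ₑ
  have hGm : AEMeasurable G P :=
    (hY 0).1.enorm.add (AEMeasurable.tsum fun t => (hincr t).1.enorm)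
  have hGfin : ∫⁻ ω, G ω ∂P ≠ ⊤ := by
    rw [lintegral_add_left' (hY 0).1.enorm, lintegral_tsum fun t => (hincr t).1.enorm]
    simp only [← ofReal_integral_norm_eq_lintegral_enorm (hincr _)]
    exact ENNReal.add_ne_top.2 ⟨(hY 0).2.ne, hsum.tsum_ofReal_ne_top⟩
  refine ⟨fun ω => (G ω).toReal, integrable_toReal_of_lintegral_ne_top hGm hGfin, ?_⟩
  filter_upwards [ae_lt_top' hGm hGfin] with ω hω t
  rw [← toReal_enorm]
  exact ENNReal.toReal_mono hω.ne (enorm_le_add_tsum_enorm_sub (fun t => Y t ω) t)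

end Increments

/-- The process `Y` is absorbed in `g` at the random time `T`: almost surely `Y t = g` for every
`t ≥ T`. Nothing is required where `T = ⊤`. -/
def AbsorbedAt {Ω E : Type*} [MeasurableSpace Ω] (P : Measure Ω) (Y : ℕ → Ω → E)
    (T : Ω → ℕ∞) (g : Ω → E) : Prop :=
  ∀ᵐ ω ∂P, ∀ t : ℕ, T ω ≤ t → Y t ω = g ω

namespace AbsorbedAt

variable {Ω E : Type*} {mΩ : MeasurableSpace Ω} {P : Measure Ω} {T : Ω → ℕ∞}

theorem ae_tendsto [TopologicalSpace E] {Y : ℕ → Ω → E} {g : Ω → E} (h : AbsorbedAt P Y T g)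
    (hT : ∀ᵐ ω ∂P, T ω ≠ ⊤) : ∀ᵐ ω ∂P, Tendsto (fun t => Y t ω) atTop (nhds (g ω)) := by
  filter_upwards [h, hT] with ω hω hTω
  lift T ω to ℕ using hTω with k
  refine tendsto_const_nhds.congr' ?_
  filter_upwards [eventually_ge_atTop k] with t ht
  exact (hω t (by exact_mod_cast ht)).symm

variable [NormedAddCommGroup E] {Y : ℕ → Ω → E} {g : Ω → E}

theorem tendsto_integral_of_bound [NormedSpace ℝ E] (h : AbsorbedAt P Y T g)
    (hT : ∀ᵐ ω ∂P, T ω ≠ ⊤) (hY : ∀ t, AEStronglyMeasurable (Y t) P) {G : Ω → ℝ}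
    (hG : Integrable G P) (hYG : ∀ᵐ ω ∂P, ∀ t, ‖Y t ω‖ ≤ G ω) :
    Integrable g P ∧ Tendsto (fun t => ∫ ω, Y t ω ∂P) atTop (nhds (∫ ω, g ω ∂P)) := by
  refine ⟨hG.mono' (aestronglyMeasurable_of_tendsto_ae atTop hY (h.ae_tendsto hT)) ?_,
    tendsto_integral_of_dominated_convergence G hY hG (ae_all_iff.1 hYG) (h.ae_tendsto hT)⟩
  filter_upwards [h.ae_tendsto hT, hYG] with ω hlim hω
  exact le_of_tendsto hlim.norm (Eventually.of_forall hω)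

theorem tendsto_integral_of_summable [NormedSpace ℝ E] (h : AbsorbedAt P Y T g)
    (hT : ∀ᵐ ω ∂P, T ω ≠ ⊤) (hY : ∀ t, Integrable (Y t) P)
    (hsum : Summable fun t => ∫ ω, ‖Y (t + 1) ω - Y t ω‖ ∂P) :
    Integrable g P ∧ Tendsto (fun t => ∫ ω, Y t ω ∂P) atTop (nhds (∫ ω, g ω ∂P)) :=
  have ⟨_, hG, hYG⟩ := exists_integrable_bound_of_summable hY hsum
  h.tendsto_integral_of_bound hT (fun t => (hY t).1) hG hYG

theorem ae_norm_sub_eq_zero (h : AbsorbedAt P Y T g) (t : ℕ) :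
    ∀ᵐ ω ∂P, T ω ≤ t → ‖Y (t + 1) ω - Y t ω‖ = 0 := by
  filter_upwards [h] with ω hω hT
  rw [hω t hT, hω (t + 1) (hT.trans (by exact_mod_cast t.le_succ)), sub_self, norm_zero]

theorem summable_integral_norm_sub_of_bounded (h : AbsorbedAt P Y T g) {c : ℕ}
    (hT : ∀ᵐ ω ∂P, T ω ≤ c) : Summable fun t => ∫ ω, ‖Y (t + 1) ω - Y t ω‖ ∂P := by
  refine summable_of_ne_finset_zero (s := Finset.range c) fun t ht => integral_eq_zero_of_ae ?_
  filter_upwards [h.ae_norm_sub_eq_zero t, hT] with ω hω hTω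
  exact hω (hTω.trans (by simpa using ht))

theorem integral_norm_sub_le [IsFiniteMeasure P] (h : AbsorbedAt P Y T g) {ℱ : Filtration ℕ mΩ}
    (hT : IsStoppingTime ℱ T) (hY : ∀ t, Integrable (Y t) P) {t : ℕ} {b : ℝ}
    (hb : P[fun ω => ‖Y (t + 1) ω - Y t ω‖ | ℱ t] ≤ᵐ[P] fun _ => b) :
    ∫ ω, ‖Y (t + 1) ω - Y t ω‖ ∂P ≤ P.real {ω | (t : ℕ∞) < T ω} * b := by
  have hincr : Integrable (fun ω => ‖Y (t + 1) ω - Y t ω‖) P := ((hY _).sub (hY t)).norm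
  calc ∫ ω, ‖Y (t + 1) ω - Y t ω‖ ∂P
      = ∫ ω in {ω | (t : ℕ∞) < T ω}, ‖Y (t + 1) ω - Y t ω‖ ∂P :=
        (setIntegral_eq_integral_of_ae_compl_eq_zero
          ((h.ae_norm_sub_eq_zero t).mono fun ω hω ht => hω (not_lt.1 ht))).symm
    _ = ∫ ω in {ω | (t : ℕ∞) < T ω}, (P[fun ω => ‖Y (t + 1) ω - Y t ω‖ | ℱ t]) ω ∂P :=
        (setIntegral_condExp (ℱ.le t) hincr (hT.measurableSet_gt t)).symm
    _ ≤ ∫ _ in {ω | (t : ℕ∞) < T ω}, b ∂P :=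
        setIntegral_mono_ae integrable_condExp.integrableOn (integrable_const b).integrableOn hb
    _ = P.real {ω | (t : ℕ∞) < T ω} * b := by rw [setIntegral_const, smul_eq_mul]

theorem summable_integral_norm_sub_of_condExp_le [IsFiniteMeasure P] (h : AbsorbedAt P Y T g)
    {ℱ : Filtration ℕ mΩ} (hT : IsStoppingTime ℱ T) (hY : ∀ t, Integrable (Y t) P) {b : ℕ → ℝ}
    (hb : ∀ᶠ t in atTop, P[fun ω => ‖Y (t + 1) ω - Y t ω‖ | ℱ t] ≤ᵐ[P] fun _ => b t)
    (hsum : Summable fun t : ℕ => P.real {ω | (t : ℕ∞) < T ω} * b t) :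
    Summable fun t => ∫ ω, ‖Y (t + 1) ω - Y t ω‖ ∂P := by
  refine summable_of_isBigO_nat hsum (.of_norm_eventuallyLE ?_)
  filter_upwards [hb] with t ht
  rw [Real.norm_of_nonneg (integral_nonneg fun _ => norm_nonneg _)]
  exact h.integral_norm_sub_le hT hY ht

end AbsorbedAt

namespace UpdateElt

variable {n : ℕ} (j : Fin n) (u : UpdateElt n)

theorem canYield_sample_iff {δ : ProbabilityMeasure ℝ} {x y : Fin n → ℝ} :
    (sample δ).CanYield j x y ↔
      y j ∈ (δ : Measure ℝ).support ∧ y = Function.update x j (y j) := by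
  constructor
  · rintro ⟨v, hv, rfl⟩
    simpa using hv
  · rintro ⟨hv, hy⟩
    exact ⟨y j, hv, hy⟩

theorem measurableSet_canYield :
    MeasurableSet {p : (Fin n → ℝ) × (Fin n → ℝ) | u.CanYield j p.1 p.2} := by
  cases u with
  | bot => exact measurableSet_eq_fun measurable_snd measurable_fst
  | assign u =>
    exact measurableSet_eq_fun measurable_snd ((measurable_update j).comp
      (measurable_fst.prodMk (u.measurable_eval.comp measurable_fst)))
  | sample δ =>
    have hj : Measurable fun p : (Fin n → ℝ) × (Fin n → ℝ) => p.2 j :=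
      (measurable_pi_apply j).comp measurable_snd
    simp only [canYield_sample_iff]
    exact (hj Measure.isClosed_support.measurableSet).inter (measurableSet_eq_fun measurable_snd
      ((measurable_update j).comp (measurable_fst.prodMk hj)))

theorem ae_canYield (x : Fin n → ℝ) : ∀ᵐ y ∂u.law j x, u.CanYield j x y := by
  have hmeas : MeasurableSet {y | u.CanYield j x y} :=
    measurable_prodMk_left (u.measurableSet_canYield j)
  cases u with
  | bot => exact (ae_dirac_iff hmeas).2 rfl
  | assign u => exact (ae_dirac_iff hmeas).2 rfl
  | sample δ =>
    refine (ae_map_iff ((measurable_update j).comp measurable_prodMk_left).aemeasurable hmeas).2 ?_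
    filter_upwards [Measure.support_mem_ae (μ := (δ : Measure ℝ))] with v hv
    exact ⟨v, hv, rfl⟩

end UpdateElt

namespace PCFG

section Paths

variable {L : Type*} {n m : ℕ} {C : PCFG L n m}

theorem Succ.eq_of_locOut {s s' : State L n} (h : C.Succ s s') (hs : s.1 = C.locOut) :
    s' = s := by
  obtain ⟨τ, hτ, hone, -, hbot⟩ := C.locOut_loop
  obtain ⟨τ', hen, hpos, hval⟩ := h
  obtain rfl : τ' = τ := (hτ τ').1 (hen.1.trans hs)
  have hloc : s'.1 ∈ τ'.1.2.support := (PMF.mem_support_iff _ _).2 hpos.ne'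
  rw [(PMF.apply_eq_one_iff _ _).1 hone] at hloc
  rw [hbot] at hval
  exact Prod.ext (hloc.trans hs.symm) hval

theorem timeTerm_le_iff {ρ : ℕ → State L n} {t : ℕ} :
    C.timeTerm ρ ≤ t ↔ ∃ i ≤ t, (ρ i).1 = C.locOut := by
  rw [← ENat.lt_add_one_iff (ENat.natCast_ne_top t), timeTerm]
  simp only [iInf_lt_iff, ← Nat.cast_add_one, Nat.cast_lt, Nat.lt_succ_iff, exists_prop, and_comm]

theorem loc_toNat_timeTerm {ρ : ℕ → State L n} (h : C.timeTerm ρ ≠ ⊤) :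
    (ρ (C.timeTerm ρ).toNat).1 = C.locOut := by
  have hT := ENat.natCast_toNat h
  obtain ⟨i, hi, hloc⟩ := timeTerm_le_iff.1 hT.ge
  have hle : C.timeTerm ρ ≤ i := timeTerm_le_iff.2 ⟨i, le_rfl, hloc⟩
  rwa [le_antisymm (ENat.toNat_le_of_le_natCast hle) hi]

namespace IsRun

variable {ρ : ℕ → State L n}

theorem reachable (hρ : C.IsRun ρ) (i : ℕ) : C.Reachable (ρ i) := by
  induction i with
  | zero => rw [hρ.1]; exact .refl
  | succ i ih => exact ih.tail (hρ.2 i)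

theorem eq_of_le (hρ : C.IsRun ρ) {i j : ℕ} (hi : (ρ i).1 = C.locOut) (hij : i ≤ j) :
    ρ j = ρ i := by
  induction j, hij using Nat.le_induction with
  | base => rfl
  | succ j _ ih => exact ((hρ.2 j).eq_of_locOut (ih ▸ hi)).trans ih

theorem eq_of_timeTerm_le (hρ : C.IsRun ρ) {t : ℕ} (ht : C.timeTerm ρ ≤ t) :
    ρ t = ρ (C.timeTerm ρ).toNat :=
  hρ.eq_of_le (loc_toNat_timeTerm (ne_top_of_le_ne_top (ENat.natCast_ne_top t) ht))
    (ENat.toNat_le_of_le_natCast ht)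

theorem loc_eq_locOut (hρ : C.IsRun ρ) {t : ℕ} (ht : C.timeTerm ρ ≤ t) :
    (ρ t).1 = C.locOut := by
  rw [hρ.eq_of_timeTerm_le ht]
  exact loc_toNat_timeTerm (ne_top_of_le_ne_top (ENat.natCast_ne_top t) ht)

theorem process_min_timeTerm (hρ : C.IsRun ρ) (η : StateFunction L n) (f : (Fin m → ℝ) → ℝ)
    (t : ℕ) : C.process η f (min (t : ℕ∞) (C.timeTerm ρ)).toNat ρ = C.process η f t ρ := by
  rcases le_total (t : ℕ∞) (C.timeTerm ρ) with h | h
  · rw [min_eq_left h, ENat.toNat_natCast]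
  · rw [min_eq_right h, process, process, hρ.eq_of_timeTerm_le h]

theorem process_eq_output (hρ : C.IsRun ρ) {I : PredicateFunction L n} (hI : C.IsInvariant I)
    {η : StateFunction L n} (hη : ∀ x, (I C.locOut).Sat x → (η C.locOut).eval x = 0)
    (f : (Fin m → ℝ) → ℝ) {t : ℕ} (ht : C.timeTerm ρ ≤ t) :
    C.process η f t ρ = f (C.output ρ) := by
  have hloc := hρ.loc_eq_locOut ht
  have hzero : (η (ρ t).1).eval (ρ t).2 = 0 := by
    rw [hloc]
    exact hη _ (hloc ▸ hI _ (hρ.reachable t))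
  rw [process, hzero, zero_add, output, hρ.eq_of_timeTerm_le ht]

end IsRun

end Paths

/-- The function of the state whose values along a trajectory form `C.process η f`; it isolates
the Markovian structure of that process. -/
def stateValue {L : Type*} {n m : ℕ} (C : PCFG L n m) (η : StateFunction L n)
    (f : (Fin m → ℝ) → ℝ) (s : State L n) : ℝ :=
  (η s.1).eval s.2 + f (C.proj s.2)

section Measurability

variable {L : Type*} [MeasurableSpace L] [DiscreteMeasurableSpace L] {n m : ℕ}
  (C : PCFG L n m)

theorem measurableSet_succ : MeasurableSet {p : State L n × State L n | C.Succ p.1 p.2} := by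
  simp only [Succ, Set.ofPred_exists]
  refine MeasurableSet.iUnion fun τ => (measurable_fst (C.measurableSet_enabled τ)).inter
    (.inter ?_ ?_)
  · exact (measurable_fst.comp measurable_snd)
      (MeasurableSet.of_discrete (s := {ℓ : L | 0 < τ.1.2 ℓ}))
  · exact ((measurable_snd.comp measurable_fst).prodMk (measurable_snd.comp measurable_snd))
      (UpdateElt.measurableSet_canYield _ _)

theorem measurable_stateValue [Countable L] (η : StateFunction L n) {f : (Fin m → ℝ) → ℝ}
    (hf : Measurable f) : Measurable (C.stateValue η f) :=
  (measurable_from_prod_countable_right fun ℓ => (η ℓ).measurable_eval).add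
    (hf.comp ((measurable_pi_iff.2 fun _ => measurable_pi_apply _).comp measurable_snd))

theorem stronglyAdapted_process [Countable L] (η : StateFunction L n) {f : (Fin m → ℝ) → ℝ}
    (hf : Measurable f) :
    StronglyAdapted (Filtration.piLE (X := fun _ : ℕ => State L n)) (C.process η f) :=
  fun t => ((C.measurable_stateValue η hf).comp (measurable_piLE_eval t)).stronglyMeasurable

theorem isStoppingTime_timeTerm :
    IsStoppingTime (Filtration.piLE (X := fun _ : ℕ => State L n)) C.timeTerm := by
  intro t
  change MeasurableSet[Filtration.piLE t] {ρ | C.timeTerm ρ ≤ t}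
  simp only [timeTerm_le_iff, ← exists_prop, Set.ofPred_exists]
  exact .iUnion fun i => .iUnion fun hi => (Filtration.piLE.mono hi) _
    ((measurable_fst.comp (measurable_piLE_eval i)) (MeasurableSet.of_discrete (s := {C.locOut})))

end Measurability

section OneStep

variable {L : Type*} {n m : ℕ} (C : PCFG L n m)

instance isProbabilityMeasure_nextLaw (τ : C.transitions) (x : Fin n → ℝ) :
    IsProbabilityMeasure (C.nextLaw τ x) :=
  UpdateElt.isProbabilityMeasure_law _ _ _

theorem enabled_enabledTransition (s : State L n) : C.Enabled (C.enabledTransition s) s :=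
  (C.enabledTransition_eq_iff s _).1 rfl

variable [Fintype L] [MeasurableSpace L] [DiscreteMeasurableSpace L] (s : State L n)

theorem stepKernel_apply : C.stepKernel s =
    (C.enabledTransition s).1.2.toMeasure.prod (C.nextLaw (C.enabledTransition s) s.2) := rfl

theorem ae_succ_stepKernel : ∀ᵐ s' ∂C.stepKernel s, C.Succ s s' := by
  have hloc : ∀ᵐ ℓ ∂(C.enabledTransition s).1.2.toMeasure, 0 < (C.enabledTransition s).1.2 ℓ :=
    (ae_pmf_toMeasure_iff _).2 fun _ => pos_iff_ne_zero.2
  have hval := UpdateElt.ae_canYield (C.up (C.enabledTransition s)).1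
    (C.up (C.enabledTransition s)).2 s.2
  rw [stepKernel_apply]
  filter_upwards [Measure.quasiMeasurePreserving_fst.ae hloc,
    Measure.quasiMeasurePreserving_snd.ae hval] with s' hloc hval
  exact ⟨_, C.enabled_enabledTransition s, hloc, hval⟩

variable {C s} {E : Type*} [NormedAddCommGroup E] {h : State L n → E}

theorem integrable_nextLaw_of_stepKernel (hh : Integrable h (C.stepKernel s)) {ℓ : L}
    (hℓ : (C.enabledTransition s).1.2 ℓ ≠ 0) :
    Integrable (fun y => h (ℓ, y)) (C.nextLaw (C.enabledTransition s) s.2) := by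
  rw [stepKernel_apply] at hh
  exact (ae_pmf_toMeasure_iff _).1 hh.prod_right_ae ℓ hℓ

theorem integral_stepKernel [NormedSpace ℝ E] [CompleteSpace E]
    (hh : Integrable h (C.stepKernel s)) :
    ∫ s', h s' ∂C.stepKernel s = ∑ ℓ, ((C.enabledTransition s).1.2 ℓ).toReal •
      ∫ y, h (ℓ, y) ∂C.nextLaw (C.enabledTransition s) s.2 := by
  rw [stepKernel_apply] at hh ⊢
  rw [integral_prod _ hh, PMF.integral_eq_sum]

variable {I : PredicateFunction L n} {f : (Fin m → ℝ) → ℝ} {η : StateFunction L n}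

theorem IsUESM.integral_stepKernel_le (hη : C.IsUESM I f η) (hs : (I s.1).Sat s.2)
    (hint : Integrable (C.stateValue η f) (C.stepKernel s)) :
    ∫ s', C.stateValue η f s' ∂C.stepKernel s ≤ C.stateValue η f s := by
  obtain ⟨hloc, hguard⟩ := C.enabled_enabledTransition s
  have hstep := hη.expected_decrease _ s.2 (hloc ▸ hs) hguard fun _ =>
    integrable_nextLaw_of_stepKernel hint
  rw [hloc] at hstep
  rw [integral_stepKernel hint]
  exact sub_le_iff_le_add.1 hstep

theorem IsLESM.le_integral_stepKernel (hη : C.IsLESM I f η) (hs : (I s.1).Sat s.2)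
    (hint : Integrable (C.stateValue η f) (C.stepKernel s)) :
    C.stateValue η f s ≤ ∫ s', C.stateValue η f s' ∂C.stepKernel s := by
  obtain ⟨hloc, hguard⟩ := C.enabled_enabledTransition s
  have hstep := hη.expected_increase _ s.2 (hloc ▸ hs) hguard fun _ =>
    integrable_nextLaw_of_stepKernel hint
  rw [hloc] at hstep
  rw [integral_stepKernel hint]
  exact le_sub_iff_add_le.1 hstep

end OneStep

section Trajectories

variable {L : Type*} [Fintype L] [MeasurableSpace L] [DiscreteMeasurableSpace L] {n m : ℕ}
  (C : PCFG L n m)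

theorem ae_zero_eq_init : ∀ᵐ ρ ∂C.runMeasure, ρ 0 = C.init := by
  have hlaw : C.runMeasure.map (Preorder.frestrictLe 0) = Measure.dirac fun _ => C.init := by
    rw [runMeasure, Kernel.traj_map_frestrictLe_apply, Kernel.partialTraj_self, Kernel.id_apply]
  have hae : ∀ᵐ x ∂C.runMeasure.map (Preorder.frestrictLe 0),
      x ⟨0, Finset.mem_Iic.2 le_rfl⟩ = C.init := by
    have hmeas : MeasurableSet {x : Π _ : Finset.Iic 0, State L n |
        x ⟨0, Finset.mem_Iic.2 le_rfl⟩ = C.init} :=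
      measurable_pi_apply (X := fun _ : Finset.Iic 0 => State L n) _
        (measurableSet_singleton (C.init : State L n))
    rw [hlaw]
    exact (ae_dirac_iff hmeas).2 rfl
  exact ae_of_ae_map (by fun_prop) hae

theorem ae_succ (t : ℕ) : ∀ᵐ ρ ∂C.runMeasure, C.Succ (ρ t) (ρ (t + 1)) := by
  let last (p : (Π _ : Finset.Iic t, State L n) × State L n) : State L n × State L n :=
    (p.1 ⟨t, Finset.mem_Iic.2 le_rfl⟩, p.2)
  have hlast : Measurable last := by fun_prop
  have hae : ∀ᵐ p ∂C.runMeasure.map fun ρ => (Preorder.frestrictLe t ρ, ρ (t + 1)),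
      C.Succ (last p).1 (last p).2 := by
    rw [runMeasure, ← Kernel.partialTraj_compProd_eq_map_traj (Nat.zero_le t)]
    exact (Measure.ae_compProd_iff (hlast C.measurableSet_succ)).2
      (ae_of_all _ fun x => C.ae_succ_stepKernel _)
  exact ae_of_ae_map (p := fun p => C.Succ (last p).1 (last p).2) (by fun_prop) hae

theorem ae_isRun : ∀ᵐ ρ ∂C.runMeasure, C.IsRun ρ := by
  filter_upwards [C.ae_zero_eq_init, ae_all_iff.2 C.ae_succ] with ρ h₀ hsucc
  exact ⟨h₀, hsucc⟩

theorem map_succ_traj_historyKernel (t : ℕ) (x : Π _ : Finset.Iic t, State L n) :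
    (Kernel.traj (X := fun _ => State L n) C.historyKernel t x).map (fun ρ => ρ (t + 1)) =
      C.stepKernel (x ⟨t, Finset.mem_Iic.2 le_rfl⟩) := by
  rw [← Kernel.map_apply _ (measurable_pi_apply _), Kernel.map_traj_succ_self]
  rfl

variable {C} {E : Type*} [NormedAddCommGroup E] {h : State L n → E} {t : ℕ}

theorem ae_integrable_stepKernel (hh : StronglyMeasurable h)
    (hint : Integrable (fun ρ => h (ρ (t + 1))) C.runMeasure) :
    ∀ᵐ ρ ∂C.runMeasure, Integrable h (C.stepKernel (ρ t)) := by
  filter_upwards [Kernel.integrable_traj (Nat.zero_le t) _ hint] with ρ hρ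
  have hmap := C.map_succ_traj_historyKernel t (Preorder.frestrictLe t ρ)
  rw [Preorder.frestrictLe_apply] at hmap
  rw [← hmap]
  exact (integrable_map_measure hh.aestronglyMeasurable
    (measurable_pi_apply (t + 1)).aemeasurable).2 hρ

theorem condExp_comp_succ_ae_eq [NormedSpace ℝ E] [CompleteSpace E] (hh : StronglyMeasurable h)
    (hint : Integrable (fun ρ => h (ρ (t + 1))) C.runMeasure) :
    C.runMeasure[fun ρ => h (ρ (t + 1)) | Filtration.piLE (X := fun _ : ℕ => State L n) t]
      =ᵐ[C.runMeasure] fun ρ => ∫ s, h s ∂C.stepKernel (ρ t) := by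
  filter_upwards [Kernel.condExp_traj (Nat.zero_le t) hint] with ρ hρ
  refine hρ.trans ?_
  have hmap := C.map_succ_traj_historyKernel t (Preorder.frestrictLe t ρ)
  rw [Preorder.frestrictLe_apply] at hmap
  rw [← hmap, integral_map (measurable_pi_apply (t + 1)).aemeasurable hh.aestronglyMeasurable]

end Trajectories

section Martingales

variable {L : Type*} [Fintype L] [MeasurableSpace L] [DiscreteMeasurableSpace L] {n m : ℕ}
  {C : PCFG L n m} {I : PredicateFunction L n} {f : (Fin m → ℝ) → ℝ} {η : StateFunction L n}

theorem IsUESM.supermartingale_process (hη : C.IsUESM I f η) (hI : C.IsInvariant I)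
    (hf : Measurable f) (hint : ∀ t, Integrable (C.process η f t) C.runMeasure) :
    Supermartingale (C.process η f) (Filtration.piLE (X := fun _ : ℕ => State L n))
      C.runMeasure := by
  have hmeas := (C.measurable_stateValue η hf).stronglyMeasurable
  refine supermartingale_nat (C.stronglyAdapted_process η hf) hint fun t => ?_
  filter_upwards [condExp_comp_succ_ae_eq hmeas (hint (t + 1)),
    ae_integrable_stepKernel hmeas (hint (t + 1)), C.ae_isRun] with ρ hcond hstep hρ
  exact hcond.trans_le (hη.integral_stepKernel_le (hI _ (hρ.reachable t)) hstep)

theorem IsLESM.submartingale_process (hη : C.IsLESM I f η) (hI : C.IsInvariant I)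
    (hf : Measurable f) (hint : ∀ t, Integrable (C.process η f t) C.runMeasure) :
    Submartingale (C.process η f) (Filtration.piLE (X := fun _ : ℕ => State L n))
      C.runMeasure := by
  have hmeas := (C.measurable_stateValue η hf).stronglyMeasurable
  refine submartingale_nat (C.stronglyAdapted_process η hf) hint fun t => ?_
  filter_upwards [condExp_comp_succ_ae_eq hmeas (hint (t + 1)),
    ae_integrable_stepKernel hmeas (hint (t + 1)), C.ae_isRun] with ρ hcond hstep hρ
  exact (hη.le_integral_stepKernel (hI _ (hρ.reachable t)) hstep).trans_eq hcond.symm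

theorem integral_process_zero (C : PCFG L n m) (η : StateFunction L n) (f : (Fin m → ℝ) → ℝ) :
    ∫ ρ, C.process η f 0 ρ ∂C.runMeasure = C.stateValue η f C.init := by
  have hconst : C.process η f 0 =ᵐ[C.runMeasure] fun _ => C.stateValue η f C.init :=
    C.ae_zero_eq_init.mono fun ρ hρ => congrArg (C.stateValue η f) hρ
  rw [integral_congr_ae hconst, integral_const, probReal_univ, one_smul]

end Martingales

section OptionalStopping

variable {L : Type*} [Fintype L] [MeasurableSpace L] [DiscreteMeasurableSpace L] {n m : ℕ}
  {C : PCFG L n m} {I : PredicateFunction L n} {f : (Fin m → ℝ) → ℝ} {η : StateFunction L n}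

theorem AlmostSurelyTerminating.ae_timeTerm_ne_top (hC : C.AlmostSurelyTerminating) :
    ∀ᵐ ρ ∂C.runMeasure, C.timeTerm ρ ≠ ⊤ := by
  have hmeas : MeasurableSet {ρ : ℕ → State L n | ∃ i, (ρ i).1 = C.locOut} := by
    rw [Set.ofPred_exists]
    exact .iUnion fun i => (measurable_fst.comp (measurable_pi_apply i))
      (MeasurableSet.of_discrete (s := {C.locOut}))
  filter_upwards [(mem_ae_iff_prob_eq_one hmeas).2 hC] with ρ ⟨i, hi⟩
  exact ne_top_of_le_ne_top (ENat.natCast_ne_top i) (timeTerm_le_iff.2 ⟨i, le_rfl, hi⟩)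

theorem absorbedAt_process (hI : C.IsInvariant I)
    (hη : ∀ x, (I C.locOut).Sat x → (η C.locOut).eval x = 0) (f : (Fin m → ℝ) → ℝ) :
    AbsorbedAt C.runMeasure (C.process η f) C.timeTerm fun ρ => f (C.output ρ) := by
  filter_upwards [C.ae_isRun] with ρ hρ t ht
  exact hρ.process_eq_output hI hη f ht

theorem OSTC2.exists_ae_norm_process_le (h : C.OSTC2 η f) :
    ∃ c : ℝ, ∀ᵐ ρ ∂C.runMeasure, ∀ t, ‖C.process η f t ρ‖ ≤ c := by
  obtain ⟨c, hc⟩ := h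
  refine ⟨c, ?_⟩
  filter_upwards [C.ae_isRun] with ρ hρ t
  rw [← hρ.process_min_timeTerm]
  exact hc t ρ hρ

theorem OSTC4.summable_integral_norm_sub {g : (ℕ → State L n) → ℝ} (h : C.OSTC4 η f)
    (habs : AbsorbedAt C.runMeasure (C.process η f) C.timeTerm g)
    (hint : ∀ t, Integrable (C.process η f t) C.runMeasure) :
    Summable fun t => ∫ ρ, ‖C.process η f (t + 1) ρ - C.process η f t ρ‖ ∂C.runMeasure := by
  obtain ⟨M, c₁, c₂, d, hc₂, htail, hM⟩ := h
  have htail' : (fun k : ℕ => C.runMeasure.real {ρ | (k : ℕ∞) < C.timeTerm ρ})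
      =O[atTop] fun k : ℕ => Real.exp (-c₂ * k) := by
    refine .of_bound c₁ (htail.mono fun k hk => ?_)
    rwa [Real.norm_of_nonneg measureReal_nonneg, Real.norm_of_nonneg (Real.exp_nonneg _)]
  refine habs.summable_integral_norm_sub_of_condExp_le C.isStoppingTime_timeTerm hint
    (b := fun k => M * (k : ℝ) ^ d) ?_ ?_
  · filter_upwards [eventually_ge_atTop 1] with t ht
    have hmono := condExp_mono (m := Filtration.piLE (X := fun _ : ℕ => State L n) t)
      ((hint (t + 1)).sub (hint t)).norm (integrable_const (M * (t : ℝ) ^ d)) (hM t ht)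
    rwa [condExp_const (Filtration.le _ t)] at hmono
  · simpa only [mul_left_comm] using
      (summable_mul_rpow_of_isBigO_exp d hc₂ htail').mul_left M

theorem OSTSound.tendsto_integral_process (h : C.OSTSound η f) (hC : C.AlmostSurelyTerminating)
    (hI : C.IsInvariant I) (hη : ∀ x, (I C.locOut).Sat x → (η C.locOut).eval x = 0)
    (hf : Measurable f) :
    Integrable f C.outputDist ∧
      Tendsto (fun t => ∫ ρ, C.process η f t ρ ∂C.runMeasure) atTop
        (nhds (∫ y, f y ∂C.outputDist)) := by
  obtain ⟨hint, hcases⟩ := h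
  have habs := absorbedAt_process hI hη f
  have hT := hC.ae_timeTerm_ne_top
  rw [outputDist, integrable_map_measure hf.aestronglyMeasurable C.measurable_output.aemeasurable,
    integral_map C.measurable_output.aemeasurable hf.aestronglyMeasurable]
  rcases hcases with ⟨c, hc⟩ | hC2 | ⟨hTfin, -, c, hc⟩ | hC4
  · exact habs.tendsto_integral_of_summable hT hint
      (habs.summable_integral_norm_sub_of_bounded hc)
  · obtain ⟨c, hc⟩ := hC2.exists_ae_norm_process_le
    exact habs.tendsto_integral_of_bound hT (fun t => (hint t).1) (integrable_const c) hc
  · have htail := summable_measureReal_lt C.measurable_timeTerm.aemeasurable hTfin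
    exact habs.tendsto_integral_of_summable hT hint
      (habs.summable_integral_norm_sub_of_condExp_le C.isStoppingTime_timeTerm hint
        (.of_forall hc) (htail.mul_right c))
  · exact habs.tendsto_integral_of_summable hT hint (hC4.summable_integral_norm_sub habs hint)

theorem IsUESM.integral_outputDist_le (hη : C.IsUESM I f η) (hC : C.AlmostSurelyTerminating)
    (hI : C.IsInvariant I) (hf : Measurable f) (hsound : C.OSTSound η f) :
    ∫ y, f y ∂C.outputDist ≤ C.stateValue η f C.init := by
  rw [← C.integral_process_zero]
  have hanti := antitone_integral_of_supermartingale (hη.supermartingale_process hI hf hsound.1)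
  exact hanti.le_of_tendsto (hsound.tendsto_integral_process hC hI hη.zero_on_output hf).2 0

theorem IsLESM.le_integral_outputDist (hη : C.IsLESM I f η) (hC : C.AlmostSurelyTerminating)
    (hI : C.IsInvariant I) (hf : Measurable f) (hsound : C.OSTSound η f) :
    C.stateValue η f C.init ≤ ∫ y, f y ∂C.outputDist := by
  rw [← C.integral_process_zero]
  have hmono := monotone_integral_of_submartingale (hη.submartingale_process hI hf hsound.1)
  exact hmono.ge_of_tendsto (hsound.tendsto_integral_process hC hI hη.zero_on_output hf).2 0

end OptionalStopping

end PCFG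

theorem theorem1 {L : Type*} [Fintype L] [MeasurableSpace L] [DiscreteMeasurableSpace L]
    {n m : ℕ} (C : PCFG L n m) (hC : C.AlmostSurelyTerminating)
    (f : (Fin m → ℝ) → ℝ) (hf : Measurable f)
    (Uf Lf : StateFunction L n) (I J : PredicateFunction L n)
    (hI : C.IsInvariant I) (hJ : C.IsInvariant J)
    (hU : C.IsUESM I f Uf) (hL : C.IsLESM J f Lf)
    (hUsound : C.OSTSound Uf f) (hLsound : C.OSTSound Lf f) :
    Integrable f C.outputDist ∧
      (Uf C.locInit).eval C.valInit + f (C.proj C.valInit) ≥ ∫ y, f y ∂C.outputDist ∧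
      (Lf C.locInit).eval C.valInit + f (C.proj C.valInit) ≤ ∫ y, f y ∂C.outputDist := by
  have hint := (hUsound.tendsto_integral_process hC hI hU.zero_on_output hf).1
  exact ⟨hint, hU.integral_outputDist_le hC hI hf hUsound,
    hL.le_integral_outputDist hC hJ hf hLsound⟩
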